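/- Let $M,N,L,m$ be integers with $M\ge 1$, $N>1$, $M\ne N$, $L>1$, $m\ge 0$; let $j_1,\dots,j_m,l_1,\dots,l_m$ be non-negative integers with $j_1+\dots+j_m=J$ and $l_1+\dots+l_m=L-1$; let $a>0$ and $z$ be real. Let $r\ge 0$ be an integer such that $l_i=0$ for every $i$ with $r<i\le m$ (for instance $r=m$), and let $b$ be a complex number with $$\Re(b)>-a\sum_{r<i\le m}j_i-1 .$$ For $t>0$ put $$F(t)=\sum_{l=0}^{L-1}\binom{L-1}{l}(-M)^lN^{L-1-l}\Big[\sum_{k=1}^{M-1}\sum_{n\ge1}\big(g_t(A_l(Mn-k))-g_t(A_lMn)\big)-\sum_{k=1}^{N-1}\sum_{n\ge1}\big(g_t(A_l(Nn-k))-g_t(A_lNn)\big)\Big],$$ where $A_l=M^lN^{L-1-l}$ and $g_t(x)=x^be^{-tx^a}$, and $$\Psi(t)=(-1)^J\frac{d^{j_1}}{dt^{j_1}}\Big(\lambda(t)^{l_1}\frac{d^{j_2}}{dt^{j_2}}\Big(\lambda(t)^{l_2}\cdots\frac{d^{j_m}}{dt^{j_m}}\big(\lambda(t)^{l_m}F(t)\big)\cdots\Big)\Big),\qquad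 \lambda(t)=\frac{\ln t}{a\ln(M/N)} .$$ Then the following series converges absolutely and $$\sum_{n\in\mathbb Z}\Big(\frac MN\Big)^{(aJ+1+b)(n+z)}\Psi\Big(\Big(\frac MN\Big)^{a(z+n)}\Big)=\operatorname{sgn}(M-N)\,\frac{(L-1)!\;\Gamma\big(\frac{1+b}{a}+J\big)}{a}.$$ In particular, for $M>N$ the sum is $(L-1)!\,\Gamma((1+b)/a+J)/a$. -/

import Mathlib

noncomputable section

namespace ZetaSeries

/-- `x ^ b * exp (-t * x ^ a)`, used for `x > 0`, real `a` and complex `b`. -/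
def expTerm (a : ℝ) (b : ℂ) (t x : ℝ) : ℂ :=
  (x : ℂ) ^ b * (Real.exp (-(t * x ^ a)) : ℂ)

/-- The Euler type sum
`∑_{k=1}^{M-1} ∑_{n≥1} ((A(Mn-k))^b e^{-t(A(Mn-k))^a} - (AMn)^b e^{-t(AMn)^a})`;
the positive integer `n` is written as `n + 1` with `n : ℕ`. -/
def eulerSum (a : ℝ) (b : ℂ) (M A : ℕ) (t : ℝ) : ℂ :=
  ∑ k ∈ Finset.Icc 1 (M - 1), ∑' n : ℕ,
    (expTerm a b t ((A : ℝ) * ((M : ℝ) * ((n : ℝ) + 1) - (k : ℝ)))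
      - expTerm a b t ((A : ℝ) * ((M : ℝ) * ((n : ℝ) + 1))))

/-- The binomial combination of Euler type sums. -/
def binomSum (a : ℝ) (b : ℂ) (M N L : ℕ) (t : ℝ) : ℂ :=
  ∑ l ∈ Finset.range L,
    ((L - 1).choose l : ℂ) * (-(M : ℂ)) ^ l * (N : ℂ) ^ (L - 1 - l) *
      (eulerSum a b M (M ^ l * N ^ (L - 1 - l)) t - eulerSum a b N (M ^ l * N ^ (L - 1 - l)) t)

/-- `(d/dt)^{j₁} ((ln t / c)^{l₁} (d/dt)^{j₂} ((ln t / c)^{l₂} ⋯ (d/dt)^{j_m} ((ln t / c)^{l_m} F(t)) ⋯ ))`,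
with `j₁, …, j_m` and `l₁, …, l_m` indexed by `Fin m`. -/
def alternating (c : ℝ) : (m : ℕ) → (Fin m → ℕ) → (Fin m → ℕ) → (ℝ → ℂ) → ℝ → ℂ
  | 0, _, _, F => F
  | m + 1, j, l, F =>
      iteratedDeriv (j 0) fun t =>
        (((Real.log t / c) ^ l 0 : ℝ) : ℂ) * alternating c m (Fin.tail j) (Fin.tail l) F t

/-- The function `Ψ`, with `J = j₁ + ⋯ + j_m` and logarithms `ln t / (a ln (M / N))`. -/
def Psi (a : ℝ) (b : ℂ) (M N L J m : ℕ) (j l : Fin m → ℕ) (t : ℝ) : ℂ :=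
  (-1) ^ J *
    alternating (a * Real.log ((M : ℝ) / (N : ℝ))) m j l (binomSum a b M N L) t

end ZetaSeries

end

/-! Put `q = M/N`, `k = L - 1`, `t = τ^a` with `τ = q^(n+z)`; then `λ(t) = n + z`. Write `S(x) =
∑_{n≥1} g_t(xn)`. Splitting into residue classes turns each Euler type sum into `S(A) - M S(AM)`,
and Pascal's rule collapses the binomial combination, so that `τ^(1+b) F(τ^a)` is `(-1)^(k+1)` times
the `(k+1)`-st forward difference in `n` of the Riemann sum `φ(n)` of `x^b e^(-x^a)` with mesh
`N^(k+1) q^(n+z)` (`cpow_mul_binomSum`).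

As the mesh tends to 0, `φ` tends to `I = Γ((1+b)/a)/a`; as it tends to infinity, `φ` tends to 0.
Both rates are geometric in `n`. Hence the sum of `Δφ` is `I` up to sign, and `k` summations by
parts against `(n+z)^p` give 0 for `p < k` and `k! I` up to sign for `p = k`
(`hasSum_pow_mul_binomSum`).

Since `-d/dt` replaces `b` by `b + a`, expanding `Ψ` yields `λ^k F_J` plus terms `t^(-(J-i)) λ^p
F_i` with `p < k`, where `F_i` is `F` with `b + ia` for `b` (`hasLeadingForm_alternating`). The
outer weight matches every such term, so the lower ones sum to 0 and only the leading one survives.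
-/

namespace ZetaSeries

/-! ### Summation by parts and telescoping over the integers -/

open Polynomial in
/-- Multiplying by polynomials and shifting the argument preserves rapid decay. -/
theorem summable_eval_mul_shift {v : ℤ → ℂ}
    (hv : ∀ P : ℂ[X], Summable fun n : ℤ => P.eval (n : ℂ) * v n) (P : ℂ[X]) :
    Summable fun n : ℤ => P.eval (n : ℂ) * v (n + 1) := by
  have h := (hv (taylor (-1) P)).comp_injective (add_left_injective (1 : ℤ))
  refine h.congr fun n => ?_
  simp [taylor_eval]

open Polynomial in
theorem summable_eval_mul_fwdDiff_iter {v : ℤ → ℂ}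
    (hv : ∀ P : ℂ[X], Summable fun n : ℤ => P.eval (n : ℂ) * v n) (k : ℕ) (P : ℂ[X]) :
    Summable fun n : ℤ => P.eval (n : ℂ) * (fwdDiff (1 : ℤ))^[k] v n := by
  induction k generalizing P with
  | zero => simpa using hv P
  | succ k ih =>
    refine ((summable_eval_mul_shift ih P).sub (ih P)).congr fun n => ?_
    rw [Function.iterate_succ_apply', fwdDiff]
    ring

-- Coefficients of a Taylor shift are values of Hasse derivatives; above degree `k` these
-- derivatives are constant, so the shift leaves the coefficients unchanged.
open Polynomial in
theorem natDegree_taylor_sub_le {P : ℂ[X]} {k : ℕ} (hP : P.natDegree ≤ k + 1) (x : ℂ) :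
    (taylor x P - P).natDegree ≤ k := by
  rw [natDegree_le_iff_coeff_eq_zero]
  intro n hn
  have hd : (hasseDeriv n P).natDegree ≤ 0 := (natDegree_hasseDeriv_le P n).trans (by omega)
  rw [coeff_sub, taylor_coeff, eq_C_of_natDegree_le_zero hd, eval_C, hasseDeriv_coeff]
  simp

-- Here the Hasse derivative is linear. The factors `k + 1` accumulate to the factorial in the
-- summation by parts.
open Polynomial in
theorem coeff_taylor_sub {P : ℂ[X]} {k : ℕ} (hP : P.natDegree ≤ k + 1) (x : ℂ) :
    (taylor x P - P).coeff k = (k + 1) * x * P.coeff (k + 1) := by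
  have hd : (hasseDeriv k P).natDegree ≤ 1 := (natDegree_hasseDeriv_le P k).trans (by omega)
  rw [coeff_sub, taylor_coeff, eq_X_add_C_of_natDegree_le_one hd]
  simp only [hasseDeriv_coeff, eval_add, eval_mul, eval_C, eval_X, zero_add, Nat.choose_self,
    add_comm 1 k, Nat.choose_succ_self_right]
  push_cast
  ring

open Polynomial in
/-- Summation by parts, `k` times, against a polynomial of degree at most `k`. -/
theorem hasSum_eval_mul_fwdDiff_iter {v : ℤ → ℂ} {c : ℂ}
    (hv : ∀ P : ℂ[X], Summable fun n : ℤ => P.eval (n : ℂ) * v n) (hc : HasSum v c)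
    (k : ℕ) (P : ℂ[X]) (hP : P.natDegree ≤ k) :
    HasSum (fun n : ℤ => P.eval (n : ℂ) * (fwdDiff (1 : ℤ))^[k] v n)
      ((-1) ^ k * k.factorial * P.coeff k * c) := by
  induction k generalizing P with
  | zero =>
    rw [eq_C_of_natDegree_le_zero hP]
    simpa using hc.mul_left (P.coeff 0)
  | succ k ih =>
    have hs := summable_eval_mul_fwdDiff_iter hv k
    -- Moving the shift from `v` to `P` leaves a backward difference of `P`, one degree lower.
    have h0 := ih _ (natDegree_taylor_sub_le hP (-1))
    have h1 := (hs (taylor (-1) P)).hasSum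
    have h2 := (hs P).hasSum
    have h3 := (h1.sub h2).unique (h0.congr_fun fun n => by rw [eval_sub, sub_mul])
    have h4 : HasSum (fun n : ℤ => P.eval (n : ℂ) * (fwdDiff (1 : ℤ))^[k] v (n + 1))
        (∑' n : ℤ, (taylor (-1) P).eval (n : ℂ) * (fwdDiff (1 : ℤ))^[k] v n) := by
      have h := (Equiv.addRight (1 : ℤ)).hasSum_iff.mpr h1
      refine h.congr_fun fun n => ?_
      simp [taylor_eval]
    have h5 := h4.sub h2
    rw [h3, coeff_taylor_sub hP] at h5
    have h6 := h5.congr_fun (g := fun n : ℤ => P.eval (n : ℂ) * (fwdDiff (1 : ℤ))^[k + 1] v n)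
      fun n => by
        rw [Function.iterate_succ_apply', fwdDiff]
        ring
    rw [show (-1) ^ (k + 1) * ((k + 1).factorial : ℂ) * P.coeff (k + 1) * c =
      (-1) ^ k * k.factorial * ((k + 1) * -1 * P.coeff (k + 1)) * c by
        rw [Nat.factorial_succ]; push_cast; ring]
    exact h6

theorem summable_int_pow_mul_exp {δ : ℝ} (hδ : 0 < δ) (p : ℕ) :
    Summable fun n : ℤ => |(n : ℝ)| ^ p * Real.exp (-(δ * |(n : ℝ)|)) := by
  have h : Summable fun n : ℕ => (n : ℝ) ^ p * Real.exp (-(δ * n)) := by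
    refine (summable_pow_mul_geometric_of_norm_lt_one (r := Real.exp (-δ)) p ?_).congr fun n => ?_
    · rw [Real.norm_of_nonneg (Real.exp_pos _).le]
      rw [← Real.exp_zero]
      exact Real.exp_lt_exp.mpr (by linarith)
    · rw [← Real.exp_nat_mul]
      congr 2
      ring
  refine Summable.of_nat_of_neg ?_ ?_
  · simpa using h
  · simpa using h

open Polynomial in
theorem summable_eval_mul_of_exp_decay {v : ℤ → ℂ} {C δ : ℝ} (hδ : 0 < δ)
    (hv : ∀ n : ℤ, ‖v n‖ ≤ C * Real.exp (-(δ * |(n : ℝ)|))) (P : ℂ[X]) :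
    Summable fun n : ℤ => P.eval (n : ℂ) * v n := by
  have h : ∀ i : ℕ, Summable fun n : ℤ => P.coeff i * (n : ℂ) ^ i * v n := by
    intro i
    refine Summable.of_norm_bounded
      ((summable_int_pow_mul_exp hδ i).mul_left (‖P.coeff i‖ * C)) fun n => ?_
    rw [norm_mul, norm_mul, norm_pow, Complex.norm_intCast]
    calc ‖P.coeff i‖ * |(n : ℝ)| ^ i * ‖v n‖
        ≤ ‖P.coeff i‖ * |(n : ℝ)| ^ i * (C * Real.exp (-(δ * |(n : ℝ)|))) := by
          gcongr
          exact hv n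
      _ = _ := by ring
  refine (summable_sum fun i (_ : i ∈ Finset.range (P.natDegree + 1)) => h i).congr fun n => ?_
  rw [eval_eq_sum_range, Finset.sum_mul]

open Filter Topology in
/-- A summable telescoping series over the integers. -/
theorem hasSum_fwdDiff_of_tendsto {φ : ℤ → ℂ} {x y : ℂ} (hs : Summable (fwdDiff (1 : ℤ) φ))
    (hx : Tendsto (fun n : ℕ => φ n) atTop (𝓝 x))
    (hy : Tendsto (fun n : ℕ => φ (-(n : ℤ))) atTop (𝓝 y)) :
    HasSum (fwdDiff (1 : ℤ) φ) (x - y) := by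
  have h := hs.hasSum
  have hfin : Tendsto (fun n : ℕ => Finset.Ico (-(n : ℤ)) n) atTop atTop := by
    refine tendsto_atTop_finset_of_monotone ?_ ?_
    · intro m n hmn
      exact Finset.Ico_subset_Ico (by omega) (by omega)
    · intro i
      exact ⟨i.natAbs + 1, by simp only [Finset.mem_Ico]; omega⟩
  have h1 := h.comp hfin
  have h2 : ∀ n : ℕ, ∑ i ∈ Finset.Ico (-(n : ℤ)) n, fwdDiff (1 : ℤ) φ i = φ n - φ (-(n : ℤ)) := by
    intro n
    induction n with
    | zero => simp
    | succ n ih =>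
      have e : Finset.Ico (-((n + 1 : ℕ) : ℤ)) ((n + 1 : ℕ) : ℤ) =
          insert (-(n : ℤ) - 1) (insert (n : ℤ) (Finset.Ico (-(n : ℤ)) n)) := by
        ext i
        simp only [Finset.mem_Ico, Finset.mem_insert]
        omega
      rw [e, Finset.sum_insert, Finset.sum_insert, ih]
      · simp only [fwdDiff]
        push_cast
        rw [sub_add_cancel, show -((n : ℤ) + 1) = -(n : ℤ) - 1 by ring]
        ring
      · simp
      · simp only [Finset.mem_insert, Finset.mem_Ico]
        omega
  have h3 : Tendsto (fun n : ℕ => φ n - φ (-(n : ℤ))) atTop (𝓝 (∑' n, fwdDiff (1 : ℤ) φ n)) :=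
    h1.congr fun n => h2 n
  rwa [tendsto_nhds_unique h3 (hx.sub hy)] at h

end ZetaSeries

/-! ### The kernel `x^b e^(-t x^a)` and its Riemann sums -/

namespace ZetaSeries

theorem norm_expTerm (a : ℝ) (b : ℂ) (t : ℝ) {x : ℝ} (hx : 0 < x) :
    ‖expTerm a b t x‖ = x ^ b.re * Real.exp (-(t * x ^ a)) := by
  rw [expTerm, norm_mul, Complex.norm_cpow_eq_rpow_re_of_pos hx,
    Complex.norm_of_nonneg (Real.exp_pos _).le]

/-- The exponential factor absorbs any power at infinity. -/
theorem exists_rpow_mul_exp_le {a t σ β : ℝ} (ha : 0 < a) (ht : 0 < t) (h : σ ≤ β) :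
    ∃ C, 0 ≤ C ∧ ∀ x : ℝ, 0 < x → x ^ β * Real.exp (-(t * x ^ a)) ≤ C * x ^ σ := by
  -- For `x ≥ 1`, the `k`-th term of the exponential series supplies `x^(ak)`, and `ak ≥ β - σ`
  -- suffices.
  obtain ⟨k, hk⟩ := exists_nat_ge ((β - σ) / a)
  rw [div_le_iff₀ ha] at hk
  refine ⟨1 + k.factorial / t ^ k, by positivity, fun x hx => ?_⟩
  have hxσ := Real.rpow_pos_of_pos hx σ
  have hxβ := Real.rpow_pos_of_pos hx β
  have hxa := Real.rpow_pos_of_pos hx a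
  have hc : 0 ≤ (k.factorial : ℝ) / t ^ k := by positivity
  rcases le_total x 1 with h1 | h1
  · calc x ^ β * Real.exp (-(t * x ^ a)) ≤ x ^ σ * 1 := by
          gcongr ?_ * ?_
          · exact Real.rpow_le_rpow_of_exponent_ge hx h1 h
          · exact Real.exp_le_one_iff.mpr (by nlinarith)
      _ ≤ (1 + k.factorial / t ^ k) * x ^ σ := by nlinarith
  · have hy : 0 < t * x ^ a := by positivity
    have h2 : Real.exp (-(t * x ^ a)) ≤ k.factorial / (t * x ^ a) ^ k := by
      rw [Real.exp_neg, inv_le_comm₀ (Real.exp_pos _) (by positivity), inv_div]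
      exact Real.pow_div_factorial_le_exp _ hy.le k
    have h3 : x ^ β ≤ x ^ σ * (x ^ a) ^ k := by
      rw [← Real.rpow_mul_natCast hx.le, ← Real.rpow_add hx]
      exact Real.rpow_le_rpow_of_exponent_le h1 (by linarith)
    calc x ^ β * Real.exp (-(t * x ^ a))
        ≤ (x ^ σ * (x ^ a) ^ k) * (k.factorial / (t * x ^ a) ^ k) := by gcongr
      _ = k.factorial / t ^ k * x ^ σ := by
          rw [mul_pow]
          field_simp
      _ ≤ (1 + k.factorial / t ^ k) * x ^ σ := by nlinarith

theorem exists_norm_expTerm_le {a t σ : ℝ} (b : ℂ) (ha : 0 < a) (ht : 0 < t) (h : σ ≤ b.re) :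
    ∃ C, 0 ≤ C ∧ ∀ x : ℝ, 0 < x → ‖expTerm a b t x‖ ≤ C * x ^ σ := by
  obtain ⟨C, hC, hb⟩ := exists_rpow_mul_exp_le ha ht h
  exact ⟨C, hC, fun x hx => by rw [norm_expTerm a b t hx]; exact hb x hx⟩

theorem expTerm_rpow (a : ℝ) (b : ℂ) {τ x : ℝ} (hτ : 0 < τ) (hx : 0 < x) :
    (τ : ℂ) ^ b * expTerm a b (τ ^ a) x = expTerm a b 1 (τ * x) := by
  rw [expTerm, expTerm, Real.mul_rpow hτ.le hx.le, one_mul, Complex.ofReal_mul,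
    Complex.mul_cpow_ofReal_nonneg hτ.le hx.le, mul_assoc]

theorem hasDerivAt_expTerm_time (a : ℝ) (b : ℂ) (t : ℝ) {x : ℝ} (hx : 0 < x) :
    HasDerivAt (fun t => expTerm a b t x) (-expTerm a (b + a) t x) t := by
  have h : HasDerivAt (fun t : ℝ => Real.exp (-(t * x ^ a)))
      (Real.exp (-(t * x ^ a)) * (-(1 * x ^ a))) t :=
    (((hasDerivAt_id' t).mul_const (x ^ a)).fun_neg).exp
  refine (h.ofReal_comp.const_mul ((x : ℂ) ^ b)).congr_deriv ?_
  have hx' : (x : ℂ) ≠ 0 := by exact_mod_cast hx.ne'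
  rw [expTerm, Complex.cpow_add _ _ hx', ← Complex.ofReal_cpow hx.le]
  push_cast
  ring

theorem hasDerivAt_expTerm (a : ℝ) (b : ℂ) {x : ℝ} (hx : 0 < x) :
    HasDerivAt (expTerm a b 1) (b * expTerm a (b - 1) 1 x - a * expTerm a (b + (a - 1 : ℝ)) 1 x)
      x := by
  have hx' : (x : ℂ) ≠ 0 := by exact_mod_cast hx.ne'
  have h1 : HasDerivAt (fun x : ℝ => (x : ℂ) ^ b) (b * (x : ℂ) ^ (b - 1) * 1) x :=
    ((hasDerivAt_id' (x : ℂ)).cpow_const (Or.inl (by simpa using hx))).comp_ofReal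
  have h2 : HasDerivAt (fun x : ℝ => Real.exp (-(1 * x ^ a)))
      (Real.exp (-(1 * x ^ a)) * (-(1 * (a * x ^ (a - 1))))) x :=
    (((Real.hasDerivAt_rpow_const (Or.inl hx.ne')).const_mul 1).fun_neg).exp
  refine (h1.fun_mul h2.ofReal_comp).congr_deriv ?_
  rw [expTerm, expTerm, Complex.cpow_add _ _ hx', ← Complex.ofReal_cpow hx.le]
  push_cast
  ring

-- The substitution `y = x^a` reduces this to the Gamma integral at `(b+1)/a`.
open MeasureTheory Set in
theorem integrableOn_expTerm {a : ℝ} {b : ℂ} (ha : 0 < a) (hb : -1 < b.re) :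
    IntegrableOn (expTerm a b 1) (Ioi 0) := by
  have hre : 0 < ((b + 1) / (a : ℂ)).re := by
    rw [Complex.div_ofReal_re]
    exact div_pos (by simp; linarith) ha
  have h : MellinConvergent (fun x : ℝ => (Real.exp (-x) : ℂ)) ((b + 1) / (a : ℂ)) :=
    (Complex.GammaIntegral_convergent hre).congr_fun (fun x _ => by simp [mul_comm])
      measurableSet_Ioi
  rw [← MellinConvergent.comp_rpow ha.ne'] at h
  refine IntegrableOn.congr_fun h (fun x _ => ?_) measurableSet_Ioi
  simp [expTerm]

open MeasureTheory Set in
theorem integral_expTerm {a : ℝ} (b : ℂ) (ha : 0 < a) (hb : -1 < b.re) :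
    ∫ x in Ioi 0, expTerm a b 1 x = Complex.Gamma ((1 + b) / a) / a := by
  have hre : 0 < ((b + 1) / (a : ℂ)).re := by
    rw [Complex.div_ofReal_re]
    exact div_pos (by simp; linarith) ha
  have h := mellin_comp_rpow (fun x : ℝ => (Real.exp (-x) : ℂ)) (b + 1) a
  rw [← Complex.GammaIntegral_eq_mellin, ← Complex.Gamma_eq_integral hre, abs_of_pos ha] at h
  rw [add_comm 1 b, div_eq_inv_mul, ← Complex.ofReal_inv, ← Complex.real_smul, ← h, mellin]
  refine setIntegral_congr_fun measurableSet_Ioi fun x _ => ?_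
  simp [expTerm]

-- Mean value inequality on one cell: as `γ - 1 ≤ 0`, the derivative bound is largest at the left
-- endpoint.
open Set in
theorem norm_integral_sub_smul_le {f f' : ℝ → ℂ} {C γ x ε : ℝ} (hx : 0 < x) (hε : 0 ≤ ε)
    (hγ : γ ≤ 1) (hC : 0 ≤ C) (hf : ∀ y, 0 < y → HasDerivAt f (f' y) y)
    (hf' : ∀ y, 0 < y → ‖f' y‖ ≤ C * y ^ (γ - 1)) :
    ‖ε * f x - ∫ y in x..(x + ε), f y‖ ≤ C * x ^ (γ - 1) * ε * ε := by
  have hcont : ContinuousOn f (uIcc x (x + ε)) := by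
    rw [uIcc_of_le (by linarith)]
    exact fun y hy => (hf y (hx.trans_le hy.1)).continuousAt.continuousWithinAt
  have e : ε * f x - ∫ y in x..(x + ε), f y = ∫ y in x..(x + ε), (f x - f y) := by
    rw [intervalIntegral.integral_sub (by simp) hcont.intervalIntegrable,
      intervalIntegral.integral_const]
    simp
  rw [e]
  refine (intervalIntegral.norm_integral_le_of_norm_le_const
    (C := C * x ^ (γ - 1) * ε) fun y hy => ?_).trans_eq ?_
  · rw [uIoc_of_le (by linarith)] at hy
    have h := (convex_Icc x (x + ε)).norm_image_sub_le_of_norm_hasDerivWithin_le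
      (f := f) (f' := f') (C := C * x ^ (γ - 1))
      (fun u hu => (hf u (hx.trans_le hu.1)).hasDerivWithinAt)
      (fun u hu => (hf' u (hx.trans_le hu.1)).trans (by
        gcongr C * ?_
        exact Real.rpow_le_rpow_of_nonpos hx hu.1 (by linarith)))
      (⟨hy.1.le, hy.2⟩ : y ∈ Icc x (x + ε)) (⟨le_rfl, by linarith⟩ : x ∈ Icc x (x + ε))
    refine h.trans ?_
    gcongr
    rw [Real.norm_eq_abs, abs_sub_comm, abs_of_pos (by linarith [hy.1])]
    linarith [hy.2]
  · rw [add_sub_cancel_left, abs_of_nonneg hε]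

open MeasureTheory Set Filter Topology in
/-- Riemann sums of a function with a power singularity at the origin. -/
theorem exists_norm_riemannSum_sub_integral_le {f f' : ℝ → ℂ} {C γ : ℝ} (hγ : -1 < γ)
    (hγ0 : γ < 0) (hC : 0 ≤ C) (hf : ∀ y, 0 < y → HasDerivAt f (f' y) y)
    (hfb : ∀ y, 0 < y → ‖f y‖ ≤ C * y ^ γ) (hf' : ∀ y, 0 < y → ‖f' y‖ ≤ C * y ^ (γ - 1))
    (hi : IntegrableOn f (Ioi 0)) (hs : ∀ ε, 0 < ε → Summable fun n : ℕ => f (ε * (n + 1))) :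
    ∃ D, ∀ ε : ℝ, 0 < ε →
      ‖ε * ∑' n : ℕ, f (ε * (n + 1)) - ∫ x in Ioi 0, f x‖ ≤ D * ε ^ (1 + γ) := by
  have hz : Summable fun n : ℕ => ((n : ℝ) + 1) ^ (γ - 1) := by
    have h := (summable_nat_add_iff 1).mpr (Real.summable_nat_rpow.mpr (by linarith : γ - 1 < -1))
    simpa using h
  -- The first constant collects the cell errors on `(ε, ∞)`; the second is the integral of `C y^γ`
  -- over `(0, ε)`.
  refine ⟨C * (∑' n : ℕ, ((n : ℝ) + 1) ^ (γ - 1)) + C / (1 + γ), fun ε hε => ?_⟩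
  have hint : ∀ x y, 0 ≤ x → x ≤ y → IntervalIntegrable f volume x y := fun x y hx hxy =>
    (intervalIntegrable_iff_integrableOn_Ioc_of_le hxy).mpr
      (hi.mono_set fun u hu => hx.trans_lt hu.1)
  have hpart : ∀ n : ℕ, ∑ k ∈ Finset.range n,
      (ε * f (ε * (k + 1)) - ∫ y in (ε * (k + 1))..(ε * (k + 1) + ε), f y) =
      ε * (∑ k ∈ Finset.range n, f (ε * (k + 1))) - ∫ y in ε..(ε * (n + 1)), f y := by
    intro n
    induction n with
    | zero => simp
    | succ n ih =>
      have hn : ε ≤ ε * (n + 1) := by nlinarith [(Nat.cast_nonneg n : (0 : ℝ) ≤ n)]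
      rw [Finset.sum_range_succ, ih, Finset.sum_range_succ,
        ← intervalIntegral.integral_add_adjacent_intervals (b := ε * (n + 1))
          (c := ε * ((n + 1 : ℕ) + 1)) (hint _ _ hε.le hn)
          (hint _ _ (hε.le.trans hn) (by push_cast; nlinarith)),
        show ε * ((n + 1 : ℕ) + 1) = ε * (n + 1) + ε by push_cast; ring]
      ring
  have hlim : Tendsto (fun n : ℕ => ε * (∑ k ∈ Finset.range n, f (ε * (k + 1))) -
      ∫ y in ε..(ε * (n + 1)), f y) atTop
      (𝓝 (ε * (∑' k : ℕ, f (ε * (k + 1))) - ∫ y in Ioi ε, f y)) := by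
    refine ((hs ε hε).hasSum.tendsto_sum_nat.const_mul _).sub ?_
    refine intervalIntegral_tendsto_integral_Ioi ε (hi.mono_set (Ioi_subset_Ioi hε.le)) ?_
    exact (tendsto_atTop_add_const_right _ 1 tendsto_natCast_atTop_atTop).const_mul_atTop hε
  have htail : ‖ε * (∑' k : ℕ, f (ε * (k + 1))) - ∫ y in Ioi ε, f y‖ ≤
      C * (∑' n : ℕ, ((n : ℝ) + 1) ^ (γ - 1)) * ε ^ (1 + γ) := by
    refine le_of_tendsto hlim.norm (Eventually.of_forall fun n => ?_)
    rw [← hpart]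
    refine (norm_sum_le_of_le _ fun k _ => norm_integral_sub_smul_le (by positivity) hε.le
      (by linarith) hC hf hf').trans ?_
    have e : ∀ k : ℕ, C * (ε * ((k : ℝ) + 1)) ^ (γ - 1) * ε * ε =
        C * ε ^ (1 + γ) * ((k : ℝ) + 1) ^ (γ - 1) := by
      intro k
      rw [Real.mul_rpow hε.le (by positivity), show (1 : ℝ) + γ = (γ - 1) + 1 + 1 by ring,
        Real.rpow_add_one hε.ne', Real.rpow_add_one hε.ne']
      ring
    rw [Finset.sum_congr rfl fun k _ => e k, ← Finset.mul_sum]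
    calc _ ≤ C * ε ^ (1 + γ) * ∑' n : ℕ, ((n : ℝ) + 1) ^ (γ - 1) := by
          gcongr
          exact hz.sum_le_tsum _ fun i _ => by positivity
      _ = _ := by ring
  have hhead : ‖∫ y in (0 : ℝ)..ε, f y‖ ≤ C / (1 + γ) * ε ^ (1 + γ) := by
    refine (intervalIntegral.norm_integral_le_of_norm_le hε.le (g := fun y => C * y ^ γ)
      (Eventually.of_forall fun y hy => hfb y hy.1)
      ((intervalIntegral.intervalIntegrable_rpow' hγ).const_mul C)).trans_eq ?_
    rw [intervalIntegral.integral_const_mul, integral_rpow (Or.inl hγ), Real.zero_rpow (by linarith),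
      add_comm γ 1]
    ring
  have hsplit : ∫ x in Ioi 0, f x = (∫ y in (0 : ℝ)..ε, f y) + ∫ y in Ioi ε, f y := by
    rw [intervalIntegral.integral_interval_add_Ioi hi (hi.mono_set (Ioi_subset_Ioi hε.le))]
  rw [hsplit, add_comm (∫ y in (0 : ℝ)..ε, f y), ← sub_sub, add_mul]
  exact (norm_sub_le _ _).trans (add_le_add htail hhead)

theorem summable_expTerm {a t x : ℝ} (b : ℂ) (ha : 0 < a) (ht : 0 < t) (hx : 0 < x) :
    Summable fun n : ℕ => expTerm a b t (x * (n + 1)) := by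
  obtain ⟨C, hC, hb⟩ := exists_norm_expTerm_le (σ := min b.re (-2)) b ha ht (min_le_left _ _)
  have hz : Summable fun n : ℕ => ((n : ℝ) + 1) ^ (min b.re (-2)) := by
    have h := (summable_nat_add_iff 1).mpr (Real.summable_nat_rpow.mpr
      (by linarith [min_le_right b.re (-2)] : min b.re (-2) < -1))
    simpa using h
  refine Summable.of_norm_bounded (hz.mul_left (C * x ^ (min b.re (-2)))) fun n => ?_
  refine (hb _ (by positivity)).trans_eq ?_
  rw [Real.mul_rpow hx.le (by positivity)]
  ring

/-- The Riemann sum `ε ∑_{n ≥ 1} (ε n)^b e^{-(ε n)^a}`. -/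
noncomputable def riemannSum (a : ℝ) (b : ℂ) (ε : ℝ) : ℂ :=
  ε * ∑' n : ℕ, expTerm a b 1 (ε * (n + 1))

/-- Majorizing the kernel by `C x^(-2)` gives `ε · ε^(-2)`; this is useful for large `ε`. -/
theorem exists_norm_riemannSum_le {a : ℝ} {b : ℂ} (ha : 0 < a) (hb : -1 < b.re) :
    ∃ C, ∀ ε : ℝ, 0 < ε → ‖riemannSum a b ε‖ ≤ C * ε⁻¹ := by
  obtain ⟨C, hC, hb⟩ := exists_norm_expTerm_le (σ := -2) b ha one_pos (by linarith)
  have hz : Summable fun n : ℕ => ((n : ℝ) + 1) ^ (-2 : ℝ) := by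
    have h := (summable_nat_add_iff 1).mpr
      (Real.summable_nat_rpow.mpr (by norm_num : (-2 : ℝ) < -1))
    simpa using h
  refine ⟨C * ∑' n : ℕ, ((n : ℝ) + 1) ^ (-2 : ℝ), fun ε hε => ?_⟩
  have h := tsum_of_norm_bounded (f := fun n : ℕ => expTerm a b 1 (ε * (n + 1)))
    (hz.hasSum.mul_left (C * ε ^ (-2 : ℝ))) fun n => by
      refine (hb _ (by positivity)).trans_eq ?_
      rw [Real.mul_rpow hε.le (by positivity)]
      ring
  rw [riemannSum, norm_mul, Complex.norm_of_nonneg hε.le]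
  refine (mul_le_mul_of_nonneg_left h hε.le).trans_eq ?_
  rw [Real.rpow_neg hε.le, Real.rpow_two]
  field_simp

theorem exists_norm_riemannSum_sub_le {a : ℝ} {b : ℂ} (ha : 0 < a) (hb : -1 < b.re) :
    ∃ D α : ℝ, 0 < α ∧ ∀ ε : ℝ, 0 < ε →
      ‖riemannSum a b ε - Complex.Gamma ((1 + b) / a) / a‖ ≤ D * ε ^ α := by
  -- The exponent must satisfy `γ > -1` for integrability at 0 and `γ < 0` for convergence of `∑
  -- n^(γ-1)`.
  set γ := min b.re (-1 / 2) with hγ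
  have h1 : γ ≤ b.re := min_le_left _ _
  have h2 : γ ≤ -1 / 2 := min_le_right _ _
  have h3 : -1 < γ := lt_min hb (by norm_num)
  obtain ⟨C₀, hC₀, h₀⟩ := exists_norm_expTerm_le (σ := γ) b ha one_pos h1
  obtain ⟨C₁, hC₁, h₁⟩ := exists_norm_expTerm_le (σ := γ - 1) (b - 1) ha one_pos
    (by simpa using h1)
  obtain ⟨C₂, hC₂, h₂⟩ := exists_norm_expTerm_le (σ := γ - 1) (b + (a - 1 : ℝ)) ha one_pos
    (by rw [Complex.add_re, Complex.ofReal_re]; linarith)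
  obtain ⟨D, hD⟩ := exists_norm_riemannSum_sub_integral_le (f := expTerm a b 1)
    (C := C₀ + (‖b‖ * C₁ + a * C₂)) h3 (by linarith) (by positivity)
    (fun y hy => hasDerivAt_expTerm a b hy)
    (fun y hy => (h₀ y hy).trans (by
      gcongr
      have : 0 ≤ ‖b‖ * C₁ + a * C₂ := by positivity
      linarith))
    (fun y hy => by
      refine (norm_sub_le _ _).trans ?_
      rw [norm_mul, norm_mul, Complex.norm_of_nonneg ha.le]
      have hy' := Real.rpow_pos_of_pos hy (γ - 1)
      calc _ ≤ ‖b‖ * (C₁ * y ^ (γ - 1)) + a * (C₂ * y ^ (γ - 1)) := by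
            gcongr
            · exact h₁ y hy
            · exact h₂ y hy
        _ ≤ _ := by nlinarith)
    (integrableOn_expTerm ha hb) (fun ε hε => summable_expTerm b ha one_pos hε)
  refine ⟨D, 1 + γ, by linarith, fun ε hε => ?_⟩
  rw [← integral_expTerm b ha hb]
  exact hD ε hε

/-- The sum `∑_{n ≥ 1} (x n)^b e^{-t (x n)^a}`. -/
noncomputable def scaledSum (a : ℝ) (b : ℂ) (x t : ℝ) : ℂ :=
  ∑' n : ℕ, expTerm a b t (x * (n + 1))

theorem scaledSum_rpow (a : ℝ) (b : ℂ) {τ x : ℝ} (hτ : 0 < τ) (hx : 0 < x) :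
    (τ : ℂ) ^ (1 + b) * (x * scaledSum a b x (τ ^ a)) = riemannSum a b (τ * x) := by
  have hτ' : (τ : ℂ) ≠ 0 := by exact_mod_cast hτ.ne'
  have h : (τ : ℂ) ^ b * scaledSum a b x (τ ^ a) = ∑' n : ℕ, expTerm a b 1 (τ * x * (n + 1)) := by
    rw [scaledSum, ← tsum_mul_left]
    refine tsum_congr fun n => ?_
    rw [expTerm_rpow a b hτ (by positivity), mul_assoc]
  rw [riemannSum, ← h, Complex.cpow_add _ _ hτ', Complex.cpow_one]
  push_cast
  ring

-- Termwise differentiation on `(t/2, ∞)`, where the differentiated terms are dominated by their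
-- values at `t/2`.
open Set in
theorem hasDerivAt_scaledSum {a x t : ℝ} (b : ℂ) (ha : 0 < a) (hx : 0 < x) (ht : 0 < t) :
    HasDerivAt (scaledSum a b x) (-scaledSum a (b + a) x t) t := by
  have ht2 : 0 < t / 2 := half_pos ht
  have h := hasDerivAt_tsum_of_isPreconnected
    (g := fun (n : ℕ) (s : ℝ) => expTerm a b s (x * (n + 1)))
    (g' := fun (n : ℕ) (s : ℝ) => -expTerm a (b + a) s (x * (n + 1)))
    (t := Ioi (t / 2)) (y₀ := t) (y := t)
    (summable_expTerm (b + a) ha ht2 hx).norm isOpen_Ioi isPreconnected_Ioi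
    (fun n s _ => hasDerivAt_expTerm_time a b s (by positivity))
    (fun n s hs => by
      have hxn : 0 < x * ((n : ℝ) + 1) := by positivity
      rw [norm_neg, norm_expTerm _ _ _ hxn, norm_expTerm _ _ _ hxn]
      have := Real.rpow_pos_of_pos hxn a
      gcongr
      exact (mem_Ioi.mp hs).le)
    (half_lt_self ht) (summable_expTerm b ha ht hx) (half_lt_self ht)
  rw [tsum_neg] at h
  exact h

end ZetaSeries

/-! ### Expansion of the alternating derivatives by powers of the logarithm -/

namespace ZetaSeries

/-- The span of the functions `t^{-(J-i)} (ln t / c)^p F_i(t)` with `i₀ ≤ i ≤ J` and `p < K`. -/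
def lowerSpan (c : ℝ) (F : ℕ → ℝ → ℂ) (i₀ J K : ℕ) : Submodule ℂ (ℝ → ℂ) :=
  Submodule.span ℂ {G | ∃ i p, i₀ ≤ i ∧ i ≤ J ∧ p < K ∧
    G = fun t : ℝ => ((t : ℂ) ^ (J - i))⁻¹ * ((Real.log t / c : ℝ) : ℂ) ^ p * F i t}

/-- `G` agrees on `t > 0` with `(-1)^J (ln t / c)^K F_J(t)`, up to terms with fewer logarithms. -/
def HasLeadingForm (c : ℝ) (F : ℕ → ℝ → ℂ) (i₀ J K : ℕ) (G : ℝ → ℂ) : Prop :=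
  ∃ R ∈ lowerSpan c F i₀ J K, ∀ t : ℝ, 0 < t →
    G t = (-1) ^ J * ((Real.log t / c : ℝ) : ℂ) ^ K * F J t + R t

theorem mem_lowerSpan {c : ℝ} {F : ℕ → ℝ → ℂ} {i₀ J K i p e : ℕ} (hi : i₀ ≤ i) (he : e + i = J)
    (hp : p < K) :
    (fun t : ℝ => ((t : ℂ) ^ e)⁻¹ * ((Real.log t / c : ℝ) : ℂ) ^ p * F i t) ∈
      lowerSpan c F i₀ J K := by
  refine Submodule.subset_span ⟨i, p, hi, by omega, hp, ?_⟩
  rw [show J - i = e by omega]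

theorem lowerSpan_zero_eq_bot (c : ℝ) (F : ℕ → ℝ → ℂ) (i₀ J : ℕ) : lowerSpan c F i₀ J 0 = ⊥ := by
  simp [lowerSpan]

variable {c : ℝ} {F : ℕ → ℝ → ℂ} {i₀ J K : ℕ} {G R : ℝ → ℂ}

/-- No term gains a logarithm, and each raises `e + i` by exactly one, which keeps the weights
homogeneous. -/
theorem hasDerivAt_term (hF : ∀ i t, 0 < t → HasDerivAt (F i) (-F (i + 1) t) t) (i p e : ℕ)
    {t : ℝ} (ht : 0 < t) :
    HasDerivAt (fun t : ℝ => ((t : ℂ) ^ e)⁻¹ * ((Real.log t / c : ℝ) : ℂ) ^ p * F i t)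
      ((-(e : ℂ)) * (((t : ℂ) ^ (e + 1))⁻¹ * ((Real.log t / c : ℝ) : ℂ) ^ p * F i t)
        + (p / c : ℂ) * (((t : ℂ) ^ (e + 1))⁻¹ * ((Real.log t / c : ℝ) : ℂ) ^ (p - 1) * F i t)
        - ((t : ℂ) ^ e)⁻¹ * ((Real.log t / c : ℝ) : ℂ) ^ p * F (i + 1) t) t := by
  have ht' : (t : ℂ) ≠ 0 := by exact_mod_cast ht.ne'
  have h1 : HasDerivAt (fun t : ℝ => ((t : ℂ) ^ e)⁻¹) (-(e : ℂ) * ((t : ℂ) ^ (e + 1))⁻¹) t := by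
    have h : HasDerivAt (fun t : ℝ => (t ^ e)⁻¹) (-(e : ℝ) * (t ^ (e + 1))⁻¹) t := by
      refine ((hasDerivAt_pow e t).fun_inv (pow_ne_zero e ht.ne')).congr_deriv ?_
      rcases e with _ | e
      · simp
      · simp only [Nat.add_sub_cancel]
        field_simp
        ring
    simpa using h.ofReal_comp
  have h2 : HasDerivAt (fun t : ℝ => ((Real.log t / c : ℝ) : ℂ) ^ p)
      ((p / c : ℂ) * (((t : ℂ))⁻¹ * ((Real.log t / c : ℝ) : ℂ) ^ (p - 1))) t := by
    have h : HasDerivAt (fun t : ℝ => (Real.log t / c) ^ p)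
        (p * (Real.log t / c) ^ (p - 1) * (t⁻¹ / c)) t :=
      ((Real.hasDerivAt_log ht.ne').div_const c).fun_pow p
    have h' := h.ofReal_comp
    simp only [Complex.ofReal_pow] at h'
    refine h'.congr_deriv ?_
    push_cast
    ring
  refine ((h1.fun_mul h2).fun_mul (hF i t ht)).congr_deriv ?_
  rw [pow_succ, mul_inv]
  ring

theorem exists_hasDerivAt_of_mem_lowerSpan
    (hF : ∀ i t, 0 < t → HasDerivAt (F i) (-F (i + 1) t) t) (hR : R ∈ lowerSpan c F i₀ J K) :
    ∃ R' ∈ lowerSpan c F i₀ (J + 1) K, ∀ t : ℝ, 0 < t → HasDerivAt R (R' t) t := by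
  induction hR using Submodule.span_induction with
  | mem G hG =>
    obtain ⟨i, p, hi, hiJ, hp, rfl⟩ := hG
    refine ⟨_, ?_, fun t ht => hasDerivAt_term hF i p (J - i) ht⟩
    refine Submodule.sub_mem _ (Submodule.add_mem _ ?_ ?_) ?_
    · exact Submodule.smul_mem _ (-((J - i : ℕ) : ℂ)) (mem_lowerSpan hi (by omega) hp)
    · exact Submodule.smul_mem _ (p / c : ℂ) (mem_lowerSpan hi (by omega) (by omega))
    · exact mem_lowerSpan (by omega) (by omega) hp
  | zero => exact ⟨0, Submodule.zero_mem _, fun t _ => hasDerivAt_const t 0⟩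
  | add x y _ _ hx hy =>
    obtain ⟨x', hx', hx⟩ := hx
    obtain ⟨y', hy', hy⟩ := hy
    exact ⟨x' + y', Submodule.add_mem _ hx' hy', fun t ht => (hx t ht).add (hy t ht)⟩
  | smul a x _ hx =>
    obtain ⟨x', hx', hx⟩ := hx
    exact ⟨a • x', Submodule.smul_mem _ a hx', fun t ht => (hx t ht).const_smul a⟩

theorem HasLeadingForm.deriv (hF : ∀ i t, 0 < t → HasDerivAt (F i) (-F (i + 1) t) t)
    (hJ : i₀ ≤ J) (hG : HasLeadingForm c F i₀ J K G) :
    HasLeadingForm c F i₀ (J + 1) K (deriv G) := by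
  obtain ⟨R, hR, hG⟩ := hG
  obtain ⟨R', hR', hRd⟩ := exists_hasDerivAt_of_mem_lowerSpan hF hR
  -- Differentiating the leading logarithm costs one power and leaves `F J`, an admissible index
  -- because `i₀ ≤ J`.
  refine ⟨((-1) ^ J * (K / c : ℂ)) • (fun t : ℝ =>
    ((t : ℂ) ^ 1)⁻¹ * ((Real.log t / c : ℝ) : ℂ) ^ (K - 1) * F J t) + R', ?_, fun t ht => ?_⟩
  · refine Submodule.add_mem _ ?_ hR'
    rcases Nat.eq_zero_or_pos K with rfl | hK
    · simp
    · exact Submodule.smul_mem _ _ (mem_lowerSpan hJ (by omega) (by omega))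
  · have h := ((hasDerivAt_term (c := c) hF J K 0 ht).const_mul ((-1) ^ J)).add (hRd t ht)
    have h' : G =ᶠ[nhds t] fun t => (-1) ^ J *
        (((t : ℂ) ^ 0)⁻¹ * ((Real.log t / c : ℝ) : ℂ) ^ K * F J t) + R t := by
      filter_upwards [lt_mem_nhds ht] with x hx
      rw [hG x hx]
      ring
    rw [(h.congr_of_eventuallyEq h').deriv]
    simp only [Pi.add_apply, Pi.smul_apply, smul_eq_mul]
    push_cast
    ring

theorem HasLeadingForm.iteratedDeriv (hF : ∀ i t, 0 < t → HasDerivAt (F i) (-F (i + 1) t) t)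
    (hJ : i₀ ≤ J) (hG : HasLeadingForm c F i₀ J K G) (n : ℕ) :
    HasLeadingForm c F i₀ (J + n) K (iteratedDeriv n G) := by
  induction n with
  | zero => simpa using hG
  | succ n ih =>
    rw [iteratedDeriv_succ]
    exact ih.deriv hF (hJ.trans (Nat.le_add_right J n))

theorem HasLeadingForm.log_pow_mul (hG : HasLeadingForm c F i₀ J K G) (k : ℕ) :
    HasLeadingForm c F i₀ J (k + K) fun t => (((Real.log t / c) ^ k : ℝ) : ℂ) * G t := by
  obtain ⟨R, hR, hG⟩ := hG
  refine ⟨fun t => (((Real.log t / c) ^ k : ℝ) : ℂ) * R t, ?_, fun t ht => ?_⟩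
  · clear hG
    induction hR using Submodule.span_induction with
    | mem G hG =>
      obtain ⟨i, p, hi, hiJ, hp, rfl⟩ := hG
      convert mem_lowerSpan (c := c) (F := F) (J := J) (K := k + K) (p := k + p) (e := J - i) hi
        (by omega) (by omega) using 1
      funext t
      push_cast
      ring
    | zero => simp only [Pi.zero_apply, mul_zero]; exact Submodule.zero_mem _
    | add x y _ _ hx hy => simp only [Pi.add_apply, mul_add]; exact Submodule.add_mem _ hx hy
    | smul a x _ hx =>
      convert Submodule.smul_mem _ a hx using 1
      funext t
      simp only [Pi.smul_apply, smul_eq_mul]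
      ring
  · simp only [hG t ht]
    push_cast
    ring

theorem HasLeadingForm.of_zero (hG : HasLeadingForm c F i₀ J 0 G) (i₁ : ℕ) :
    HasLeadingForm c F i₁ J 0 G := by
  simpa only [HasLeadingForm, lowerSpan_zero_eq_bot] using hG

/-- Until the first logarithm enters, the innermost derivatives produce no lower terms, so no
remainder has an index below the sum of those `j i`. -/
theorem hasLeadingForm_alternating (hF : ∀ i t, 0 < t → HasDerivAt (F i) (-F (i + 1) t) t)
    (m : ℕ) (j l : Fin m → ℕ) (r : ℕ) (hr : ∀ i : Fin m, r ≤ (i : ℕ) → l i = 0) :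
    HasLeadingForm c F (∑ i : Fin m, if r ≤ (i : ℕ) then j i else 0) (∑ i, j i) (∑ i, l i)
      (alternating c m j l (F 0)) := by
  induction m generalizing r with
  | zero => exact ⟨0, Submodule.zero_mem _, fun t _ => by simp [alternating]⟩
  | succ m ih =>
    have key := ih (Fin.tail j) (Fin.tail l) (r - 1)
      -- Peeling off the outermost layer lowers `r` by one, with truncation at `r = 0`.
      fun i hi => hr i.succ (by simp only [Fin.val_succ]; omega)
    have hle : (∑ i : Fin m, if r - 1 ≤ (i : ℕ) then Fin.tail j i else 0) ≤ ∑ i, Fin.tail j i :=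
      Finset.sum_le_sum fun i _ => by split_ifs <;> simp
    have h := (key.log_pow_mul (l 0)).iteratedDeriv hF hle (j 0)
    rw [Fin.sum_univ_succ j, Fin.sum_univ_succ l, add_comm (j 0)]
    rcases r with _ | r
    · have h0 : l 0 + ∑ i : Fin m, l i.succ = 0 := by
        rw [← Fin.sum_univ_succ l]
        exact Finset.sum_eq_zero fun i _ => hr i (Nat.zero_le _)
      have h1 : l 0 + ∑ i, Fin.tail l i = 0 := h0
      rw [h0]
      rw [h1] at h
      exact h.of_zero _
    · rw [Fin.sum_univ_succ]
      simp only [alternating, Fin.val_succ, Fin.val_zero, Nat.add_le_add_iff_right]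
      simpa [Fin.tail] using h

end ZetaSeries

/-! ### Binomial sums as iterated differences, and their moments -/

namespace ZetaSeries

/-- Split `scaledSum` by residues modulo `M`: the classes `Mn - k` complete the multiples of `M`,
which are subtracted `M - 1` times and are missing once. -/
theorem eulerSum_eq {a t : ℝ} (b : ℂ) {M A : ℕ} (ha : 0 < a) (ht : 0 < t) (hM : 1 ≤ M)
    (hA : 1 ≤ A) :
    eulerSum a b M A t = scaledSum a b A t - M * scaledSum a b ((A * M : ℕ) : ℝ) t := by
  obtain ⟨m, rfl⟩ : ∃ m, M = m + 1 := ⟨M - 1, by omega⟩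
  have hA' : (0 : ℝ) < A := by exact_mod_cast hA
  set f : ℕ → ℂ := fun n => expTerm a b t (A * (n + 1)) with hf_def
  have hf : Summable f := summable_expTerm b ha ht hA'
  have hinj : ∀ i : ℕ, Function.Injective fun n : ℕ => i + (m + 1) * n := by
    intro i x y h
    simpa using h
  have hlast : ∀ n : ℕ, expTerm a b t (A * (((m + 1 : ℕ) : ℝ) * ((n : ℝ) + 1))) =
      f (m + (m + 1) * n) := by
    intro n
    simp only [hf_def]
    push_cast
    congr 1
    ring
  have hS : scaledSum a b ((A * (m + 1) : ℕ) : ℝ) t = ∑' n, f (m + (m + 1) * n) := by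
    refine tsum_congr fun n => ?_
    rw [← hlast]
    push_cast
    rw [mul_assoc]
  have hres : scaledSum a b A t = ∑ i ∈ Finset.range (m + 1), ∑' n, f (i + (m + 1) * n) := by
    rw [← Fin.sum_univ_eq_sum_range (fun i => ∑' n, f (i + (m + 1) * n))]
    exact Nat.sumByResidueClasses hf (m + 1)
  -- As `f` is indexed from 0, the point `M(n+1) - k` has index `m - k + (m+1)n`.
  have hk : ∀ k ∈ Finset.Icc 1 m, (∑' n : ℕ,
      (expTerm a b t ((A : ℝ) * (((m + 1 : ℕ) : ℝ) * ((n : ℝ) + 1) - (k : ℝ)))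
        - expTerm a b t ((A : ℝ) * (((m + 1 : ℕ) : ℝ) * ((n : ℝ) + 1))))) =
      (∑' n, f (m - k + (m + 1) * n)) - ∑' n, f (m + (m + 1) * n) := by
    intro k hk
    rw [Finset.mem_Icc] at hk
    refine Eq.trans (tsum_congr fun n => ?_)
      ((hf.comp_injective (hinj (m - k))).tsum_sub (hf.comp_injective (hinj m)))
    rw [hlast]
    simp only [hf_def, Function.comp_apply]
    push_cast [Nat.cast_sub hk.2]
    congr 2
    ring
  have hsum : ∑ k ∈ Finset.Icc 1 m, ∑' n, f (m - k + (m + 1) * n) =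
      ∑ i ∈ Finset.range m, ∑' n, f (i + (m + 1) * n) := by
    refine Finset.sum_nbij' (fun k => m - k) (fun i => m - i) ?_ ?_ ?_ ?_ ?_ <;>
      simp only [Finset.mem_Icc, Finset.mem_range] <;> first | omega | simp
  rw [eulerSum, Nat.add_sub_cancel, Finset.sum_congr rfl hk, Finset.sum_sub_distrib, hsum, hres, hS,
    Finset.sum_range_succ, Finset.sum_const, Nat.card_Icc, nsmul_eq_mul]
  push_cast
  ring

/-- In each bracket `S(A)` cancels, leaving `N S(AN) - M S(AM)`; Pascal's rule merges neighbouring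
terms. -/
theorem binomSum_eq {a t : ℝ} (b : ℂ) {M N : ℕ} (k : ℕ) (ha : 0 < a) (ht : 0 < t) (hM : 1 ≤ M)
    (hN : 1 ≤ N) :
    binomSum a b M N (k + 1) t = ∑ l ∈ Finset.range (k + 2), ((k + 1).choose l : ℂ) *
      ((-(M : ℂ)) ^ l * (N : ℂ) ^ (k + 1 - l) *
        scaledSum a b ((M ^ l * N ^ (k + 1 - l) : ℕ) : ℝ) t) := by
  rw [Finset.sum_choose_succ_mul (fun i j => (-(M : ℂ)) ^ i * (N : ℂ) ^ j *
    scaledSum a b ((M ^ i * N ^ j : ℕ) : ℝ) t), ← Finset.sum_add_distrib, binomSum]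
  refine Finset.sum_congr rfl fun l hl => ?_
  have hl' : l ≤ k := by simpa [Nat.lt_succ_iff] using hl
  have hA : 1 ≤ M ^ l * N ^ (k - l) := Nat.one_le_iff_ne_zero.mpr (by positivity)
  rw [Nat.add_sub_cancel, eulerSum_eq b ha ht hM hA, eulerSum_eq b ha ht hN hA,
    show k + 1 - l = k - l + 1 by omega, pow_succ N, ← mul_assoc,
    show M ^ l * N ^ (k - l) * M = M ^ (l + 1) * N ^ (k - l) by ring]
  ring_nf

theorem hasDerivAt_binomSum {a t : ℝ} (b : ℂ) {M N : ℕ} (k : ℕ) (ha : 0 < a) (ht : 0 < t)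
    (hM : 1 ≤ M) (hN : 1 ≤ N) :
    HasDerivAt (binomSum a b M N (k + 1)) (-binomSum a (b + a) M N (k + 1) t) t := by
  have h : HasDerivAt (fun t => ∑ l ∈ Finset.range (k + 2), ((k + 1).choose l : ℂ) *
      ((-(M : ℂ)) ^ l * (N : ℂ) ^ (k + 1 - l) *
        scaledSum a b ((M ^ l * N ^ (k + 1 - l) : ℕ) : ℝ) t))
      (∑ l ∈ Finset.range (k + 2), ((k + 1).choose l : ℂ) *
      ((-(M : ℂ)) ^ l * (N : ℂ) ^ (k + 1 - l) *
        -scaledSum a (b + a) ((M ^ l * N ^ (k + 1 - l) : ℕ) : ℝ) t)) t :=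
    HasDerivAt.fun_sum fun l _ => ((hasDerivAt_scaledSum b ha (by positivity) ht).const_mul
      _).const_mul _
  refine (h.congr_of_eventuallyEq ?_).congr_deriv ?_
  · filter_upwards [lt_mem_nhds ht] with x hx
    exact binomSum_eq b k ha hx hM hN
  · rw [binomSum_eq (b + a) k ha ht hM hN, ← Finset.sum_neg_distrib]
    exact Finset.sum_congr rfl fun l _ => by ring

/-- In the variable `τ = t^{1/a}` the binomial combination is an iterated forward difference. -/
theorem cpow_mul_binomSum {a : ℝ} (b : ℂ) {M N : ℕ} (k : ℕ) (ha : 0 < a) (hM : 1 ≤ M)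
    (hN : 1 ≤ N) (z : ℝ) (n : ℤ) :
    ((((M : ℝ) / N) ^ ((n : ℝ) + z) : ℝ) : ℂ) ^ (1 + b) *
        binomSum a b M N (k + 1) ((((M : ℝ) / N) ^ ((n : ℝ) + z)) ^ a) =
      (-1) ^ (k + 1) * (fwdDiff (1 : ℤ))^[k + 1]
        (fun n : ℤ => riemannSum a b ((N : ℝ) ^ (k + 1) * ((M : ℝ) / N) ^ ((n : ℝ) + z))) n := by
  have hM' : (0 : ℝ) < M := by exact_mod_cast hM
  have hN' : (0 : ℝ) < N := by exact_mod_cast hN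
  have hq : 0 < (M : ℝ) / N := div_pos hM' hN'
  have hτ := Real.rpow_pos_of_pos hq ((n : ℝ) + z)
  rw [binomSum_eq b k ha (Real.rpow_pos_of_pos hτ a) hM hN, fwdDiff_iter_eq_sum_shift,
    Finset.mul_sum, Finset.mul_sum]
  refine Finset.sum_congr rfl fun l hl => ?_
  have hl' : l ≤ k + 1 := by simpa [Nat.lt_succ_iff] using hl
  have hx : (0 : ℝ) < ((M ^ l * N ^ (k + 1 - l) : ℕ) : ℝ) := by positivity
  have h1 := scaledSum_rpow a b hτ hx
  have h2 : (N : ℝ) ^ (k + 1) * ((M : ℝ) / N) ^ (((n + l • (1 : ℤ) : ℤ) : ℝ) + z) =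
      ((M : ℝ) / N) ^ ((n : ℝ) + z) * ((M ^ l * N ^ (k + 1 - l) : ℕ) : ℝ) := by
    have e : (((n + l • (1 : ℤ) : ℤ) : ℝ) + z) = (n : ℝ) + z + (l : ℕ) := by
      simp
      ring
    rw [e, Real.rpow_add_natCast hq.ne', div_pow]
    push_cast
    conv_lhs => rw [← Nat.sub_add_cancel hl', pow_add]
    field_simp
  have h3 : (-1 : ℂ) ^ (k + 1) * (-1) ^ (k + 1 - l) = (-1) ^ l := by
    conv_lhs => rw [← Nat.sub_add_cancel hl', Nat.add_sub_cancel, pow_add]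
    rw [mul_right_comm, ← mul_pow]
    simp
  rw [h2, ← h1, zsmul_eq_mul, neg_pow (M : ℂ), ← h3]
  push_cast
  ring

-- The two bounds control opposite ends of the geometric mesh, and the difference telescopes between
-- the limits `I` and 0; the sign of `θ` decides which end is which.
open Filter Topology in
theorem hasSum_fwdDiff_comp_exp {R : ℝ → ℂ} {I : ℂ} {C D α θ κ : ℝ} (hα : 0 < α) (hθ : θ ≠ 0)
    (hκ : 0 < κ) (hC : ∀ ε, 0 < ε → ‖R ε‖ ≤ C * ε⁻¹)
    (hD : ∀ ε, 0 < ε → ‖R ε - I‖ ≤ D * ε ^ α) :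
    (∃ C' δ : ℝ, 0 < δ ∧ ∀ n : ℤ, ‖fwdDiff (1 : ℤ) (fun n : ℤ => R (κ * Real.exp (θ * n))) n‖ ≤
        C' * Real.exp (-(δ * |(n : ℝ)|))) ∧
      HasSum (fwdDiff (1 : ℤ) fun n : ℤ => R (κ * Real.exp (θ * n)))
        (-((Real.sign θ : ℂ) * I)) := by
  have hC0 : 0 ≤ C := by simpa using (norm_nonneg _).trans (hC 1 one_pos)
  have hD0 : 0 ≤ D := by simpa using (norm_nonneg _).trans (hD 1 one_pos)
  have hpos : ∀ y, 0 < κ * Real.exp (θ * y) := fun y => by positivity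
  have hdecay : ∃ C' δ : ℝ, 0 < δ ∧
      ∀ n : ℤ, ‖fwdDiff (1 : ℤ) (fun n : ℤ => R (κ * Real.exp (θ * n))) n‖ ≤
        C' * Real.exp (-(δ * |(n : ℝ)|)) := by
    have hm : 0 < min α 1 := lt_min hα one_pos
    -- The decay rate is `|θ|` at the large-mesh end and `α|θ|` at the small-mesh end; the minimum
    -- serves both.
    refine ⟨C * κ⁻¹ * (1 + Real.exp (-θ)) + D * κ ^ α * (1 + Real.exp (α * θ)),
      |θ| * min α 1, mul_pos (abs_pos.mpr hθ) hm, fun n => ?_⟩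
    have e1 : |θ| * min α 1 * |(n : ℝ)| = min α 1 * |θ * n| := by
      rw [abs_mul]
      ring
    have hα1 : 0 ≤ C * κ⁻¹ * (1 + Real.exp (-θ)) := by positivity
    have hα2 : 0 ≤ D * κ ^ α * (1 + Real.exp (α * θ)) := by positivity
    simp only [fwdDiff]
    push_cast
    rw [e1]
    rcases le_total 0 (θ * (n : ℝ)) with h | h
    · have hexp : Real.exp (-(θ * n)) ≤ Real.exp (-(min α 1 * |θ * n|)) := by
        rw [abs_of_nonneg h]
        exact Real.exp_le_exp.mpr (by nlinarith [min_le_right α 1])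
      calc _ ≤ C * (κ * Real.exp (θ * (n + 1)))⁻¹ + C * (κ * Real.exp (θ * n))⁻¹ :=
            (norm_sub_le _ _).trans (add_le_add (hC _ (hpos _)) (hC _ (hpos _)))
        _ = C * κ⁻¹ * (1 + Real.exp (-θ)) * Real.exp (-(θ * n)) := by
            rw [mul_add, mul_one, Real.exp_add, Real.exp_neg, Real.exp_neg]
            field_simp
            ring
        _ ≤ _ := by
            gcongr
            linarith
    · have hexp : Real.exp (α * (θ * n)) ≤ Real.exp (-(min α 1 * |θ * n|)) := by
        rw [abs_of_nonpos h]
        exact Real.exp_le_exp.mpr (by nlinarith [min_le_left α 1])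
      have hpow : ∀ y : ℝ, (κ * Real.exp (θ * y)) ^ α = κ ^ α * Real.exp (α * (θ * y)) := by
        intro y
        rw [Real.mul_rpow hκ.le (Real.exp_pos _).le, ← Real.exp_mul, mul_comm α]
      calc _ = ‖(R (κ * Real.exp (θ * (n + 1))) - I) - (R (κ * Real.exp (θ * n)) - I)‖ := by
            rw [sub_sub_sub_cancel_right]
        _ ≤ D * (κ * Real.exp (θ * (n + 1))) ^ α + D * (κ * Real.exp (θ * n)) ^ α :=
            (norm_sub_le _ _).trans (add_le_add (hD _ (hpos _)) (hD _ (hpos _)))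
        _ = D * κ ^ α * (1 + Real.exp (α * θ)) * Real.exp (α * (θ * n)) := by
            rw [hpow, hpow, mul_add, mul_one, mul_add, Real.exp_add]
            ring
        _ ≤ _ := by
            gcongr
            linarith
  refine ⟨hdecay, ?_⟩
  have hs : Summable (fwdDiff (1 : ℤ) fun n : ℤ => R (κ * Real.exp (θ * n))) := by
    obtain ⟨C', δ, hδ, h⟩ := hdecay
    simpa using summable_eval_mul_of_exp_decay hδ h 1
  have htop : Tendsto R atTop (𝓝 0) := by
    refine squeeze_zero_norm' (a := fun ε => C * ε⁻¹) ?_ ?_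
    · filter_upwards [eventually_gt_atTop 0] with ε hε using hC ε hε
    · simpa using tendsto_inv_atTop_zero.const_mul C
  have hbot : Tendsto (fun y => R (κ * Real.exp y)) atBot (𝓝 I) := by
    rw [tendsto_iff_norm_sub_tendsto_zero]
    have h1 : Tendsto (fun y => D * (κ * Real.exp y) ^ α) atBot (𝓝 0) := by
      have h2 : Tendsto (fun y => κ * Real.exp y) atBot (𝓝 0) := by
        simpa using Real.tendsto_exp_atBot.const_mul κ
      have h3 := (h2.rpow_const (p := α) (Or.inr hα.le)).const_mul D
      rwa [Real.zero_rpow hα.ne', mul_zero] at h3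
    exact squeeze_zero (fun y => norm_nonneg _) (fun y => hD _ (by positivity)) h1
  have htop' : Tendsto (fun y => R (κ * Real.exp y)) atTop (𝓝 0) :=
    htop.comp (Real.tendsto_exp_atTop.const_mul_atTop hκ)
  have hcast := tendsto_natCast_atTop_atTop (R := ℝ)
  rcases hθ.lt_or_gt with h | h
  · have h1 := hasSum_fwdDiff_of_tendsto (φ := fun n : ℤ => R (κ * Real.exp (θ * n))) (x := I)
      (y := 0) hs
      (by simpa [Function.comp_def] using hbot.comp (hcast.const_mul_atTop_of_neg h))
      (by simpa [Function.comp_def] using htop'.comp (hcast.const_mul_atTop (neg_pos.mpr h)))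
    rw [Real.sign_of_neg h]
    simpa using h1
  · have h1 := hasSum_fwdDiff_of_tendsto (φ := fun n : ℤ => R (κ * Real.exp (θ * n))) (x := 0)
      (y := I) hs
      (by simpa [Function.comp_def] using htop'.comp (hcast.const_mul_atTop h))
      (by simpa [Function.comp_def] using hbot.comp (hcast.const_mul_atTop_of_neg (neg_lt_zero.mpr h)))
    rw [Real.sign_of_pos h]
    simpa using h1

theorem sign_log_div {M N : ℕ} (hM : 1 ≤ M) (hN : 1 ≤ N) (hMN : M ≠ N) :
    Real.log ((M : ℝ) / N) ≠ 0 ∧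
      Real.sign (Real.log ((M : ℝ) / N)) = Real.sign ((M : ℝ) - N) := by
  have hM' : (0 : ℝ) < M := by exact_mod_cast hM
  have hN' : (0 : ℝ) < N := by exact_mod_cast hN
  rcases hMN.lt_or_gt with h | h
  · have h' : (M : ℝ) < N := by exact_mod_cast h
    have h1 := Real.log_neg (div_pos hM' hN') ((div_lt_one hN').mpr h')
    exact ⟨h1.ne, by rw [Real.sign_of_neg h1, Real.sign_of_neg (by linarith)]⟩
  · have h' : (N : ℝ) < M := by exact_mod_cast h
    have h1 := Real.log_pos ((one_lt_div hN').mpr h')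
    exact ⟨h1.ne', by rw [Real.sign_of_pos h1, Real.sign_of_pos (by linarith)]⟩

open Polynomial in
theorem hasSum_pow_mul_binomSum {a : ℝ} {b : ℂ} {M N k p : ℕ} (ha : 0 < a) (hM : 1 ≤ M)
    (hN : 1 ≤ N) (hMN : M ≠ N) (hb : -1 < b.re) (z : ℝ) (hp : p ≤ k) :
    HasSum (fun n : ℤ => ((n : ℂ) + z) ^ p *
        (((((M : ℝ) / N) ^ ((n : ℝ) + z) : ℝ) : ℂ) ^ (1 + b) *
          binomSum a b M N (k + 1) ((((M : ℝ) / N) ^ ((n : ℝ) + z)) ^ a)))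
      (if p = k then (Real.sign ((M : ℝ) - N) : ℂ) * k.factorial *
        Complex.Gamma ((1 + b) / a) / a else 0) := by
  have hM' : (0 : ℝ) < M := by exact_mod_cast hM
  have hN' : (0 : ℝ) < N := by exact_mod_cast hN
  have hq : 0 < (M : ℝ) / N := div_pos hM' hN'
  obtain ⟨hθ, hsign⟩ := sign_log_div hM hN hMN
  obtain ⟨C₀, hC⟩ := exists_norm_riemannSum_le ha hb
  obtain ⟨D, α, hα, hD⟩ := exists_norm_riemannSum_sub_le ha hb
  have hκ : 0 < (N : ℝ) ^ (k + 1) * ((M : ℝ) / N) ^ z := by positivity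
  -- Summation by parts is applied to the first difference, since the Riemann sums themselves need
  -- not tend to 0 at both ends; this leaves `k` of the `k + 1` differences.
  obtain ⟨⟨C', δ, hδ, hdecay⟩, hsum⟩ := hasSum_fwdDiff_comp_exp hα hθ hκ hC hD
  have hφ : (fun n : ℤ => riemannSum a b ((N : ℝ) ^ (k + 1) * ((M : ℝ) / N) ^ ((n : ℝ) + z))) =
      fun n : ℤ => riemannSum a b ((N : ℝ) ^ (k + 1) * ((M : ℝ) / N) ^ z *
        Real.exp (Real.log ((M : ℝ) / N) * n)) := by
    funext n
    rw [Real.rpow_add hq, Real.rpow_def_of_pos hq (n : ℝ)]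
    congr 1
    ring
  have hdeg : ((X + C (z : ℂ)) ^ p).natDegree = p := by
    rw [natDegree_pow, natDegree_X_add_C, mul_one]
  have h := (hasSum_eval_mul_fwdDiff_iter (summable_eval_mul_of_exp_decay hδ hdecay) hsum k
    ((X + C (z : ℂ)) ^ p) (hdeg.trans_le hp)).mul_left ((-1) ^ (k + 1))
  have hval : (-1 : ℂ) ^ (k + 1) * ((-1) ^ k * k.factorial * ((X + C (z : ℂ)) ^ p).coeff k *
      -((Real.sign (Real.log ((M : ℝ) / N)) : ℂ) * (Complex.Gamma ((1 + b) / a) / a))) =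
      if p = k then (Real.sign ((M : ℝ) - N) : ℂ) * k.factorial *
        Complex.Gamma ((1 + b) / a) / a else 0 := by
    rw [hsign]
    split_ifs with hpk
    · subst hpk
      have hmonic : ((X + C (z : ℂ)) ^ p).coeff p = 1 := by
        have := ((monic_X_add_C (z : ℂ)).pow p).coeff_natDegree
        rwa [hdeg] at this
      have hsq : (-1 : ℂ) ^ p * (-1) ^ p = 1 := by
        rw [← mul_pow]
        simp
      rw [hmonic, pow_succ]
      linear_combination (Real.sign ((M : ℝ) - N) : ℂ) * p.factorial *
        (Complex.Gamma ((1 + b) / a) / a) * hsq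
    · rw [coeff_eq_zero_of_natDegree_lt (by rw [hdeg]; omega)]
      ring
  rw [hval] at h
  refine h.congr_fun fun n => ?_
  rw [cpow_mul_binomSum b k ha hM hN z n, hφ, Function.iterate_succ_apply]
  simp only [eval_pow, eval_add, eval_X, eval_C]
  ring

end ZetaSeries

/-! ### Assembly -/

open ZetaSeries in
theorem mainTheorem6
    (M N L J m : ℕ) (hM : 1 ≤ M) (hN : 1 < N) (hMN : M ≠ N) (hL : 1 < L)
    (j l : Fin m → ℕ) (hj : ∑ i, j i = J) (hl : ∑ i, l i = L - 1)
    (r : ℕ) (hr : ∀ i : Fin m, r ≤ (i : ℕ) → l i = 0)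
    (a : ℝ) (ha : 0 < a) (b : ℂ)
    (hb : -(a * (∑ i : Fin m, if r ≤ (i : ℕ) then (j i : ℝ) else 0)) - 1 < b.re)
    (z : ℝ) :
    HasSum
      (fun n : ℤ =>
        ((((M : ℝ) / (N : ℝ) : ℝ) : ℂ) ^ (((a : ℂ) * (J : ℂ) + 1 + b) * ((n : ℂ) + (z : ℂ)))) *
          ZetaSeries.Psi a b M N L J m j l (((M : ℝ) / (N : ℝ)) ^ (a * (z + (n : ℝ)))))
      ((Real.sign ((M : ℝ) - (N : ℝ)) : ℂ) * ((L - 1).factorial : ℂ) *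
        Complex.Gamma ((1 + b) / (a : ℂ) + (J : ℂ)) / (a : ℂ)) := by
  obtain ⟨k, rfl⟩ : ∃ k, L = k + 1 := ⟨L - 1, by omega⟩
  rw [Nat.add_sub_cancel] at hl ⊢
  have hM' : (0 : ℝ) < M := by exact_mod_cast hM
  have hN' : (0 : ℝ) < N := by exact_mod_cast (zero_lt_one.trans hN)
  obtain ⟨hθ, -⟩ := sign_log_div hM hN.le hMN
  have hq : 0 < (M : ℝ) / N := div_pos hM' hN'
  have haC : (a : ℂ) ≠ 0 := by exact_mod_cast ha.ne'
  set F : ℕ → ℝ → ℂ := fun i => binomSum a (b + i * a) M N (k + 1) with hF_def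
  set c : ℝ := a * Real.log ((M : ℝ) / N) with hc_def
  set i₀ : ℕ := ∑ i : Fin m, if r ≤ (i : ℕ) then j i else 0 with hi₀
  have hF : ∀ i t, 0 < t → HasDerivAt (F i) (-F (i + 1) t) t := by
    intro i t ht
    have h := hasDerivAt_binomSum (b + i * a) k ha ht hM hN.le
    rw [show b + i * a + a = b + ((i + 1 : ℕ) : ℂ) * a by push_cast; ring] at h
    exact h
  -- The lower bound on `Re b` is exactly what makes every occurring exponent `b + ia` integrable at
  -- 0.
  have hre : ∀ i, i₀ ≤ i → -1 < (b + i * a).re := by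
    intro i hi
    have h1 : (i₀ : ℝ) ≤ i := by exact_mod_cast hi
    have h2 : (i₀ : ℝ) = ∑ i : Fin m, if r ≤ (i : ℕ) then (j i : ℝ) else 0 := by
      rw [hi₀]
      push_cast
      rfl
    rw [← h2] at hb
    have h3 : (b + i * a).re = b.re + i * a := by simp
    rw [h3]
    nlinarith
  have hi₀J : i₀ ≤ J := by
    rw [← hj]
    exact Finset.sum_le_sum fun i _ => by split_ifs <;> simp
  -- Balance of weights: with `t = q^(a(n+z))`, the factor `t^(-e)` lowers `aJ` to `ai` in the
  -- exponent.
  have hterm : ∀ i p e : ℕ, e + i = J → ∀ n : ℤ,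
      ((((M : ℝ) / (N : ℝ) : ℝ) : ℂ) ^ (((a : ℂ) * (J : ℂ) + 1 + b) * ((n : ℂ) + (z : ℂ)))) *
        (((((M : ℝ) / (N : ℝ)) ^ (a * (z + (n : ℝ))) : ℝ) : ℂ) ^ e)⁻¹ *
        ((Real.log (((M : ℝ) / (N : ℝ)) ^ (a * (z + (n : ℝ)))) / c : ℝ) : ℂ) ^ p *
        F i (((M : ℝ) / (N : ℝ)) ^ (a * (z + (n : ℝ)))) =
      ((n : ℂ) + z) ^ p * (((((M : ℝ) / N) ^ ((n : ℝ) + z) : ℝ) : ℂ) ^ (1 + (b + i * a)) *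
          binomSum a (b + i * a) M N (k + 1) ((((M : ℝ) / N) ^ ((n : ℝ) + z)) ^ a)) := by
    intro i p e he n
    have hqC : (((M : ℝ) / (N : ℝ) : ℝ) : ℂ) ≠ 0 := by exact_mod_cast hq.ne'
    have h1 : Real.log (((M : ℝ) / (N : ℝ)) ^ (a * (z + (n : ℝ)))) / c = n + z := by
      rw [Real.log_rpow hq, hc_def]
      field_simp
      ring
    have h2 : (((M : ℝ) / N) ^ ((n : ℝ) + z)) ^ a = ((M : ℝ) / (N : ℝ)) ^ (a * (z + (n : ℝ))) := by
      rw [← Real.rpow_mul hq.le]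
      congr 1
      ring
    have h3 : ∀ w : ℂ, ((((M : ℝ) / N) ^ ((n : ℝ) + z) : ℝ) : ℂ) ^ w =
        (((M : ℝ) / (N : ℝ) : ℝ) : ℂ) ^ (w * ((n : ℂ) + z)) := by
      intro w
      rw [Complex.cpow_def_of_ne_zero (by exact_mod_cast (Real.rpow_pos_of_pos hq _).ne'),
        Complex.cpow_def_of_ne_zero hqC, ← Complex.ofReal_log (Real.rpow_pos_of_pos hq _).le,
        ← Complex.ofReal_log hq.le, Real.log_rpow hq]
      push_cast
      ring_nf
    have h4 : ((((M : ℝ) / (N : ℝ)) ^ (a * (z + (n : ℝ))) : ℝ) : ℂ) ^ e =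
        (((M : ℝ) / (N : ℝ) : ℝ) : ℂ) ^ (a * e * ((n : ℂ) + z)) := by
      rw [Complex.ofReal_cpow hq.le, ← Complex.cpow_nat_mul]
      congr 1
      push_cast
      ring
    rw [h1, h2, h3, h4, ← Complex.cpow_neg, ← Complex.cpow_add _ _ hqC, ← he]
    rw [show ((a : ℂ) * ((e + i : ℕ) : ℂ) + 1 + b) * ((n : ℂ) + z) + -(a * e * ((n : ℂ) + z)) =
      (1 + (b + i * a)) * ((n : ℂ) + z) by push_cast; ring]
    push_cast
    ring
  obtain ⟨R, hR, hlead⟩ := hasLeadingForm_alternating (c := c) hF m j l r hr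
  rw [hj, hl] at hlead hR
  have hRsum : HasSum (fun n : ℤ =>
      ((((M : ℝ) / (N : ℝ) : ℝ) : ℂ) ^ (((a : ℂ) * (J : ℂ) + 1 + b) * ((n : ℂ) + (z : ℂ)))) *
        R (((M : ℝ) / (N : ℝ)) ^ (a * (z + (n : ℝ))))) 0 := by
    clear hlead
    induction hR using Submodule.span_induction with
    | mem G hG =>
      obtain ⟨i, p, hi, hiJ, hp, rfl⟩ := hG
      have h := hasSum_pow_mul_binomSum ha hM hN.le hMN (hre i hi) z hp.le
      rw [if_neg hp.ne] at h
      refine h.congr_fun fun n => ?_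
      rw [← hterm i p (J - i) (by omega) n]
      ring
    | zero => simp
    | add x y _ _ hx hy =>
      have h := hx.add hy
      rw [add_zero] at h
      exact h.congr_fun fun n => by rw [Pi.add_apply, mul_add]
    | smul u x _ hx =>
      have h := hx.mul_left u
      rw [mul_zero] at h
      exact h.congr_fun fun n => by rw [Pi.smul_apply, smul_eq_mul]; ring
  have hmain := hasSum_pow_mul_binomSum (k := k) ha hM hN.le hMN (hre J hi₀J) z le_rfl
  rw [if_pos rfl, show (1 + (b + J * a)) / (a : ℂ) = (1 + b) / a + J by field_simp; ring] at hmain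
  have h := hmain.add (hRsum.mul_left ((-1) ^ J))
  rw [mul_zero, add_zero] at h
  refine h.congr_fun fun n => ?_
  have hF0 : F 0 = binomSum a b M N (k + 1) := by simp [hF_def]
  rw [hF0] at hlead
  have hsq : (-1 : ℂ) ^ J * (-1) ^ J = 1 := by
    rw [← mul_pow]
    simp
  rw [Psi, hlead _ (Real.rpow_pos_of_pos hq _), ← hterm J k 0 (zero_add J) n, pow_zero, inv_one]
  linear_combination ((((M : ℝ) / (N : ℝ) : ℝ) : ℂ) ^ (((a : ℂ) * (J : ℂ) + 1 + b) *
    ((n : ℂ) + (z : ℂ)))) * ((Real.log (((M : ℝ) / (N : ℝ)) ^ (a * (z + (n : ℝ)))) / c : ℝ) : ℂ) ^ k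
    * F J (((M : ℝ) / (N : ℝ)) ^ (a * (z + (n : ℝ)))) * hsq
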